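/- **Conventions.** A *manifold* is a second-countable Hausdorff smooth manifold without boundary; $\mathbf{Man}$ denotes a fixed small category of such manifolds (up to diffeomorphism, all of them) and smooth maps. A *typed finite set* is a finite set $A$ with a map $\tau$ from $A$ to manifolds; *typed functions* preserve $\tau$; $+$ is disjoint union. Its *dependent product* is the manifold $\overline{A}=\prod_{a\in A}\tau(a)$; a typed function $q\colon A\to B$ induces a smooth map $\overline q\colon\overline B\to\overline A$, and $\overline{A+B}\cong\overline A\times\overline B$ canonically. A *box* is a pair $X=(X^{in},X^{out})$ of typed finite sets. A *wiring diagram* $\Phi\colon X\to Y$ is a typed bijection $\varphi\colon X^{in}+Y^{out}\to X^{out}+Y^{in}$ with $\varphi(Y^{out})\subseteq X^{out}$; equivalently, it is given by its restrictions $\varphi^{in}\colon X^{in}\to X^{out}+Y^{in}$ and $\varphi^{out}\colon Y^{out}\to X^{out}$. Identities are given by the identity of $X^{in}+X^{out}$. The composite $\omega$ of $\varphi\colon X\to Y$ and $\psi\colon Y\to Z$ is $\omega^{out}=\varphi^{out}\circ\psi^{out}$ and $\omega^{in}=(\nabla+1)\circ(1+\varphi^{out}+1)\circ(1+\psi^{in})\circ\varphi^{in}$.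 With $X\oplus X'=(X^{in}+X'^{in},X^{out}+X'^{out})$, $\Phi\oplus\Phi'=\varphi+\varphi'$ and unit $0=(\varnothing,\varnothing)$, boxes and wiring diagrams form a symmetric monoidal category $\mathbf W$. An *open system* with state space $M$, input space $U$ and output space $V$ is a pair of smooth maps $f^{in}\colon M\times U\to TM$, $f^{out}\colon M\to V$ with $f^{in}(m,u)\in T_mM$. A *morphism* from $(M_1,U_1,V_1,f_1)$ to $(M_2,U_2,V_2,f_2)$ is a triple of smooth maps $\zeta_M,\zeta_U,\zeta_V$ with $T\zeta_M\circ f_1^{in}=f_2^{in}\circ(\zeta_M\times\zeta_U)$ and $\zeta_V\circ f_1^{out}=f_2^{out}\circ\zeta_M$. For a box $X$ let $\mathcal G(X)$ be the set of pairs $(S,f)$ with $S$ a typed finite set (the state variables) and $f$ an open system with state space $\overline S$, input space $\overline{X^{in}}$ and output space $\overline{X^{out}}$. For $\Phi\colon X\to Y$ let $\mathcal G(\Phi)(S,f)=(S,g)$ with $$g^{in}(s,y)=f^{in}\bigl(s,\overline{\varphi^{in}}(f^{out}(s),y)\bigr),\qquad g^{out}(s)=\overline{\varphi^{out}}(f^{out}(s)).$$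 Let $\mu_{X,X'}\colon\mathcal G(X)\times\mathcal G(X')\to\mathcal G(X\oplus X')$, $((S,f),(S',f'))\mapsto(S+S',f\times f')$, where $f\times f'$ is the product open system read through the canonical identifications $\overline{A+B}\cong\overline A\times\overline B$ and $T(M\times M')\cong TM\times TM'$, and let $\varepsilon\in\mathcal G(0)$ be the open system with no state variables. A *renaming* of $(S,f)$ into $(S',f')$ is a typed bijection $\sigma\colon S\to S'$ such that $(\overline\sigma,\mathrm{id},\mathrm{id})$ is a morphism of open systems from $f'$ to $f$. **Proposition.** $(\mathcal G,\mu,\varepsilon)$ is a lax symmetric monoidal functor $(\mathbf W,\oplus,0)\to(\mathbf{Set},\times,\star)$, i.e. a $\mathbf W$-algebra, where, as usual, disjoint unions of sets of state variables are identified along the canonical bijections. Precisely: 1. $\mathcal G(\mathrm{id}_X)=\mathrm{id}$ and $\mathcal G(\Psi\circ\Phi)=\mathcal G(\Psi)\circ\mathcal G(\Phi)$. 2. $\mu$ is natural: $\mathcal G(\Phi\oplus\Phi')(\mu(x,x'))=\mu(\mathcal G(\Phi)x,\mathcal G(\Phi')x')$. 3. The associativity, left and right unit, and symmetry conditions for $(\mu,\varepsilon)$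 hold up to the canonical bijections of state variables: for $x\in\mathcal G(X)$, $y\in\mathcal G(Y)$, $z\in\mathcal G(Z)$ with sets of state variables $S,S',S''$, the canonical bijections $(S+S')+S''\cong S+(S'+S'')$, $\varnothing+S\cong S$, $S+\varnothing\cong S$, $S+S'\cong S'+S$ are renamings of $\mathcal G(\alpha)(\mu(\mu(x,y),z))$ into $\mu(x,\mu(y,z))$, of $\mathcal G(\lambda)(\mu(\varepsilon,x))$ into $x$, of $\mathcal G(\rho)(\mu(x,\varepsilon))$ into $x$, and of $\mathcal G(\beta)(\mu(x,y))$ into $\mu(y,x)$, where $\alpha,\lambda,\rho,\beta$ are the structure isomorphisms of $\mathbf W$. 4. There is a functor $\overline{\mathcal G}\colon\mathbf W\to\mathbf{Set}$ with a natural surjection $\pi\colon\mathcal G\to\overline{\mathcal G}$ such that $\pi(x)=\pi(y)$ if and only if there is a renaming of $x$ into $y$, and $\overline{\mathcal G}$ carries a lax symmetric monoidal structure $(\overline\mu,\overline\varepsilon)$ with $\overline\mu(\pi x,\pi y)=\pi(\mu(x,y))$ and $\overline\varepsilon(\star)=\pi(\varepsilon)$. -/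

import Mathlib

open CategoryTheory MonoidalCategory
open scoped Manifold ContDiff

noncomputable section

namespace OpenDyn

/-! ### Smooth manifolds -/

/-- Second-countable Hausdorff smooth manifolds without boundary, modelled on a finite-dimensional
real vector space. -/
structure Man : Type 1 where
  carrier : Type
  E : Type
  H : Type
  [normed : NormedAddCommGroup E]
  [space : NormedSpace ℝ E]
  [findim : FiniteDimensional ℝ E]
  [topH : TopologicalSpace H]
  I : ModelWithCorners ℝ E H
  [boundaryless : I.Boundaryless]
  [top : TopologicalSpace carrier]
  [t2 : T2Space carrier]
  [secondCountable : SecondCountableTopology carrier]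
  [charted : ChartedSpace H carrier]
  [smooth : IsManifold I ∞ carrier]

namespace Man

attribute [instance] normed space findim topH boundaryless top t2 secondCountable charted smooth

instance : CoeSort Man Type := ⟨carrier⟩

end Man

/-- Smooth maps between manifolds. -/
def IsSmooth {M N : Man} (f : M → N) : Prop := ContMDiff M.I N.I ∞ f

/-- Binary product of manifolds. -/
def Man.prod (M N : Man) : Man where
  carrier := M × N
  E := M.E × N.E
  H := ModelProd M.H N.H
  I := M.I.prod N.I

namespace Man

theorem isSmooth_id (M : Man) : IsSmooth fun x : M => x := contMDiff_id

theorem isSmooth_fst (M N : Man) : IsSmooth fun x : M.prod N => x.1 := contMDiff_fst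

theorem isSmooth_snd (M N : Man) : IsSmooth fun x : M.prod N => x.2 := contMDiff_snd

theorem isSmooth_prodMk {L M N : Man} {f : L → M} {g : L → N} (hf : IsSmooth f)
    (hg : IsSmooth g) : IsSmooth (N := M.prod N) fun x => (f x, g x) := hf.prodMk hg

theorem isSmooth_comp {L M N : Man} {g : M → N} {f : L → M} (hg : IsSmooth g)
    (hf : IsSmooth f) : IsSmooth fun x => g (f x) := hg.comp hf

end Man

section PiManifold

variable {ι : Type} [Fintype ι] {E : ι → Type} [∀ i, NormedAddCommGroup (E i)]
  [∀ i, NormedSpace ℝ (E i)] {H : ι → Type} [∀ i, TopologicalSpace (H i)]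
  {I : ∀ i, ModelWithCorners ℝ (E i) (H i)}
  {M : ι → Type} [∀ i, TopologicalSpace (M i)] [∀ i, ChartedSpace (H i) (M i)]

theorem isManifold_pi [∀ i, IsManifold (I i) ∞ (M i)] :
    IsManifold (ModelWithCorners.pi I) ∞ (∀ i, M i) := by
  apply isManifold_of_contDiffOn
  rintro _ _ ⟨e, he, rfl⟩ ⟨e', he', rfl⟩
  rw [contDiffOn_pi]
  intro i
  have hi := (contDiffGroupoid ∞ (I i)).compatible (he i trivial) (he' i trivial)
  rw [contDiffGroupoid, mem_groupoid_of_pregroupoid] at hi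
  have h1 : ContDiffOn ℝ ∞ (I i ∘ ((e i).symm ≫ₕ e' i) ∘ (I i).symm)
    ((I i).symm ⁻¹' ((e i).symm ≫ₕ e' i).source ∩ Set.range (I i)) := hi.1
  refine h1.comp (ContinuousLinearMap.proj (R := ℝ) (φ := E) i).contDiff.contDiffOn ?_
  rintro v ⟨hv, w, rfl⟩
  refine ⟨?_, w i, rfl⟩
  obtain ⟨hv1, hv2⟩ := hv
  exact ⟨hv1 i trivial, hv2 i trivial⟩

theorem boundaryless_pi [∀ i, (I i).Boundaryless] : (ModelWithCorners.pi I).Boundaryless := by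
  constructor
  apply Set.eq_univ_of_forall
  intro v
  exact ⟨fun i => (I i).symm (v i), funext fun i =>
    (I i).right_inv (by rw [(I i).range_eq_univ]; trivial)⟩

theorem contMDiff_pi {F K N : Type} [NormedAddCommGroup F] [NormedSpace ℝ F] [TopologicalSpace K]
    {J : ModelWithCorners ℝ F K} [TopologicalSpace N] [ChartedSpace K N] {f : N → ∀ i, M i} :
    ContMDiff J (ModelWithCorners.pi I) ∞ f ↔ ∀ i, ContMDiff J (I i) ∞ fun x => f x i := by
  simp only [ContMDiff]
  rw [forall_comm]
  refine forall_congr' fun x => ?_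
  simp only [contMDiffAt_iff, forall_and, continuousAt_pi]
  refine and_congr Iff.rfl ?_
  rw [contDiffWithinAt_pi]
  rfl

end PiManifold

/-! ### Typed finite sets -/

/-- A finite set whose elements are labelled by manifolds. -/
structure TFS : Type 1 where
  carrier : Type
  [finite : Finite carrier]
  type : carrier → Man

namespace TFS

attribute [instance] finite

instance : CoeSort TFS Type := ⟨carrier⟩

/-- Coproduct of typed finite sets. -/
def sum (A B : TFS) : TFS where
  carrier := A ⊕ B
  type := Sum.elim A.type B.type

/-- The empty typed finite set. -/
def empty : TFS where
  carrier := Empty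
  type := Empty.elim

instance (A : TFS) : Fintype A := Fintype.ofFinite A

/-- The dependent product of a typed finite set. -/
def dprod (A : TFS) : Man where
  carrier := ∀ a : A, A.type a
  E := ∀ a : A, (A.type a).E
  H := ModelPi fun a : A => (A.type a).H
  I := ModelWithCorners.pi fun a : A => (A.type a).I
  boundaryless := boundaryless_pi
  smooth := isManifold_pi

theorem isSmooth_dprod_iff {A : TFS} {N : Man} {f : N → A.dprod} :
    IsSmooth f ↔ ∀ a, IsSmooth (N := A.type a) fun x => f x a :=
  contMDiff_pi

/-- The canonical diffeomorphism between the dependent product of a coproduct and the product of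
the dependent products. -/
def dprodSum (A B : TFS) :
    (A.sum B).dprod ≃ₘ⟮(A.sum B).dprod.I, (A.dprod.prod B.dprod).I⟯ (A.dprod.prod B.dprod) where
  toFun x := (fun a => x (Sum.inl a), fun b => x (Sum.inr b))
  invFun p := fun c => match c with
    | Sum.inl a => p.1 a
    | Sum.inr b => p.2 b
  left_inv x := by funext c; cases c <;> rfl
  right_inv p := rfl
  contMDiff_toFun := by
    have h := isSmooth_dprod_iff.1 (Man.isSmooth_id (A.sum B).dprod)
    exact Man.isSmooth_prodMk (isSmooth_dprod_iff.2 fun a => h (Sum.inl a))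
      (isSmooth_dprod_iff.2 fun b => h (Sum.inr b))
  contMDiff_invFun := by
    refine isSmooth_dprod_iff.2 fun c => ?_
    cases c with
    | inl a => exact isSmooth_dprod_iff.1 (Man.isSmooth_fst A.dprod B.dprod) a
    | inr b => exact isSmooth_dprod_iff.1 (Man.isSmooth_snd A.dprod B.dprod) b

end TFS

/-- Typed functions between typed finite sets. -/
@[ext]
structure TypedFun (A B : TFS) where
  toFun : A → B
  typed : ∀ a, B.type (toFun a) = A.type a

namespace TypedFun

variable {A B C D : TFS}

instance : CoeFun (TypedFun A B) fun _ => A → B := ⟨toFun⟩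

def id (A : TFS) : TypedFun A A := ⟨fun a => a, fun _ => rfl⟩

def comp (g : TypedFun B C) (f : TypedFun A B) : TypedFun A C :=
  ⟨fun a => g (f a), fun a => (g.typed _).trans (f.typed a)⟩

def inl (A B : TFS) : TypedFun A (A.sum B) := ⟨Sum.inl, fun _ => rfl⟩

def inr (A B : TFS) : TypedFun B (A.sum B) := ⟨Sum.inr, fun _ => rfl⟩

/-- Copairing of typed functions. -/
def elim (f : TypedFun A C) (g : TypedFun B C) : TypedFun (A.sum B) C :=
  ⟨Sum.elim f g, fun c => by cases c; exacts [f.typed _, g.typed _]⟩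

/-- Coproduct of typed functions. -/
def map (f : TypedFun A C) (g : TypedFun B D) : TypedFun (A.sum B) (C.sum D) :=
  elim ((inl C D).comp f) ((inr C D).comp g)

def swap (A B : TFS) : TypedFun (A.sum B) (B.sum A) := elim (inr B A) (inl B A)

def assoc (A B C : TFS) : TypedFun ((A.sum B).sum C) (A.sum (B.sum C)) :=
  elim (map (id A) (inl B C)) ((inr A (B.sum C)).comp (inr B C))

def assocInv (A B C : TFS) : TypedFun (A.sum (B.sum C)) ((A.sum B).sum C) :=
  elim ((inl (A.sum B) C).comp (inl A B)) (map (inr A B) (id C))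

def fromEmpty (A : TFS) : TypedFun TFS.empty A := ⟨Empty.elim, fun a => a.elim⟩

/-- The map of dependent products induced by a typed function. -/
def dprod (q : TypedFun A B) (x : B.dprod) : A.dprod :=
  fun a => cast (congrArg Man.carrier (q.typed a)) (x (q a))

theorem isSmooth_cast {L M N : Man} (h : M = N) {f : L → M} (hf : IsSmooth f) :
    IsSmooth fun x => cast (congrArg Man.carrier h) (f x) := by
  subst h; exact hf

theorem isSmooth_dprod (q : TypedFun A B) : IsSmooth q.dprod := by
  have h := TFS.isSmooth_dprod_iff.1 (Man.isSmooth_id B.dprod)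
  exact TFS.isSmooth_dprod_iff.2 fun a => isSmooth_cast (q.typed a) (h (q a))

end TypedFun

/-! ### Boxes and wiring diagrams -/

/-- A box: a pair of typed finite sets, the input ports and the output ports. -/
structure Box : Type 1 where
  inp : TFS
  out : TFS

/-- Wiring diagrams `X ⟶ Y`: typed bijections `inp X + out Y → out X + inp Y` without passing
wires. -/
@[ext]
structure WD (X Y : Box) where
  wire : TypedFun (X.inp.sum Y.out) (X.out.sum Y.inp)
  bijective : Function.Bijective wire
  no_passing : ∀ (y : Y.out) (y' : Y.inp), wire (Sum.inr y) ≠ Sum.inr y'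

namespace WD

variable {X Y Z : Box}

/-- The restriction of a wiring diagram to the inner input ports. -/
def inn (Φ : WD X Y) : TypedFun X.inp (X.out.sum Y.inp) :=
  Φ.wire.comp (TypedFun.inl X.inp Y.out)

theorem isLeft (Φ : WD X Y) (y : Y.out) : (Φ.wire (Sum.inr y) : X.out ⊕ Y.inp).isLeft := by
  rcases h : (Φ.wire (Sum.inr y) : X.out ⊕ Y.inp) with x | y'
  · rfl
  · exact absurd h (Φ.no_passing y y')

theorem inl_getLeft (Φ : WD X Y) (y : Y.out) :
    (Sum.inl ((Φ.wire (Sum.inr y) : X.out ⊕ Y.inp).getLeft (Φ.isLeft y)) : X.out ⊕ Y.inp)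
      = Φ.wire (Sum.inr y) :=
  Sum.inl_getLeft _ _

/-- The restriction of a wiring diagram to the outer output ports. -/
def out (Φ : WD X Y) : TypedFun Y.out X.out where
  toFun y := (Φ.wire (Sum.inr y) : X.out ⊕ Y.inp).getLeft (Φ.isLeft y)
  typed y := by
    have h := Φ.wire.typed (Sum.inr y)
    rw [← Φ.inl_getLeft y] at h
    exact h

theorem wire_inl (Φ : WD X Y) (x : X.inp) : Φ.wire (Sum.inl x) = Φ.inn x := rfl

theorem wire_inr (Φ : WD X Y) (y : Y.out) : Φ.wire (Sum.inr y) = Sum.inl (Φ.out y) :=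
  (Φ.inl_getLeft y).symm

/-- The wiring diagram with prescribed restrictions. -/
def ofPair (i : TypedFun X.inp (X.out.sum Y.inp)) (o : TypedFun Y.out X.out)
    (h : Function.Bijective (i.elim ((TypedFun.inl X.out Y.inp).comp o))) : WD X Y where
  wire := i.elim ((TypedFun.inl X.out Y.inp).comp o)
  bijective := h
  no_passing _ _ := Sum.inl_ne_inr

theorem ext_pair {Φ Ψ : WD X Y} (hi : ∀ x, Φ.inn x = Ψ.inn x) (ho : ∀ y, Φ.out y = Ψ.out y) :
    Φ = Ψ := by
  ext c
  rcases c with x | y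
  · exact hi x
  · rw [wire_inr, wire_inr, ho]

theorem inn_ofPair (i : TypedFun X.inp (X.out.sum Y.inp)) (o : TypedFun Y.out X.out)
    (h : Function.Bijective (i.elim ((TypedFun.inl X.out Y.inp).comp o))) (x : X.inp) :
    (ofPair i o h).inn x = i x := rfl

theorem out_ofPair (i : TypedFun X.inp (X.out.sum Y.inp)) (o : TypedFun Y.out X.out)
    (h : Function.Bijective (i.elim ((TypedFun.inl X.out Y.inp).comp o))) (y : Y.out) :
    (ofPair i o h).out y = o y := rfl

theorem card_eq (Φ : WD X Y) :
    Nat.card X.inp + Nat.card Y.out = Nat.card X.out + Nat.card Y.inp := by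
  rw [← Nat.card_sum, ← Nat.card_sum]
  exact Nat.card_congr (Equiv.ofBijective _ Φ.bijective)

theorem inn_inj (Φ : WD X Y) {x x' : X.inp} (h : Φ.inn x = Φ.inn x') : x = x' :=
  Sum.inl_injective (Φ.bijective.1 h)

theorem out_inj (Φ : WD X Y) {y y' : Y.out} (h : Φ.out y = Φ.out y') : y = y' :=
  Sum.inr_injective (Φ.bijective.1 (by rw [wire_inr, wire_inr, h]))

theorem inn_ne_out (Φ : WD X Y) (x : X.inp) (y : Y.out) : Φ.inn x ≠ Sum.inl (Φ.out y) := by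
  rw [← wire_inr]
  exact fun h => Sum.inl_ne_inr (Φ.bijective.1 h)

theorem bijective_of_card {i : TypedFun X.inp (X.out.sum Y.inp)} {o : TypedFun Y.out X.out}
    (hc : Nat.card X.inp + Nat.card Y.out = Nat.card X.out + Nat.card Y.inp)
    (hi : ∀ x x', i x = i x' → x = x') (ho : ∀ y y', o y = o y' → y = y')
    (hio : ∀ x y, i x ≠ Sum.inl (o y)) :
    Function.Bijective (i.elim ((TypedFun.inl X.out Y.inp).comp o)) := by
  refine Function.Injective.bijective_of_nat_card_le (α := X.inp ⊕ Y.out) (β := X.out ⊕ Y.inp)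
    ?_ (by rw [Nat.card_sum, Nat.card_sum, hc])
  rintro (x | y) (x' | y') h
  · exact congrArg Sum.inl (hi _ _ h)
  · exact absurd h (hio _ _)
  · exact absurd h.symm (hio _ _)
  · exact congrArg Sum.inr (ho _ _ (Sum.inl_injective h))

/-- The identity wiring diagram; it sends each port of `inp X + out X` to itself. -/
def id (X : Box) : WD X X :=
  ofPair (TypedFun.inr X.out X.inp) (TypedFun.id X.out) (bijective_of_card (add_comm _ _)
    (fun _ _ h => Sum.inr_injective h) (fun _ _ h => h) (fun _ _ => Sum.inr_ne_inl))

/-- The restriction of the composite of `Φ` and `Ψ` to the inner input ports, i.e. the composite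
`inp X → out X + inp Y → out X + (out Y + inp Z) → out X + (out X + inp Z) → out X + inp Z`. -/
def compInn (Φ : WD X Y) (Ψ : WD Y Z) : TypedFun X.inp (X.out.sum Z.inp) :=
  ((TypedFun.inl X.out Z.inp).elim (TypedFun.id (X.out.sum Z.inp))).comp
    (((TypedFun.id X.out).map (Φ.out.map (TypedFun.id Z.inp))).comp
      (((TypedFun.id X.out).map Ψ.inn).comp Φ.inn))

theorem compInn_inl {Φ : WD X Y} (Ψ : WD Y Z) {x : X.inp} {x' : X.out}
    (h : Φ.inn x = Sum.inl x') : compInn Φ Ψ x = Sum.inl x' := by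
  simp only [compInn, TypedFun.comp, h]; rfl

theorem compInn_inr_inl {Φ : WD X Y} {Ψ : WD Y Z} {x : X.inp} {y : Y.inp} {y' : Y.out}
    (h : Φ.inn x = Sum.inr y) (h' : Ψ.inn y = Sum.inl y') :
    compInn Φ Ψ x = Sum.inl (Φ.out y') := by
  simp only [compInn, TypedFun.comp, h, TypedFun.map, TypedFun.elim, Sum.elim_inr, h']; rfl

theorem compInn_inr_inr {Φ : WD X Y} {Ψ : WD Y Z} {x : X.inp} {y : Y.inp} {z : Z.inp}
    (h : Φ.inn x = Sum.inr y) (h' : Ψ.inn y = Sum.inr z) :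
    compInn Φ Ψ x = Sum.inr z := by
  simp only [compInn, TypedFun.comp, h, TypedFun.map, TypedFun.elim, Sum.elim_inr, h']; rfl

theorem compInn_cases (Φ : WD X Y) (Ψ : WD Y Z) (x : X.inp) :
    (∃ x', Φ.inn x = Sum.inl x' ∧ compInn Φ Ψ x = Sum.inl x') ∨
    (∃ y y', Φ.inn x = Sum.inr y ∧ Ψ.inn y = Sum.inl y' ∧ compInn Φ Ψ x = Sum.inl (Φ.out y')) ∨
    (∃ y z, Φ.inn x = Sum.inr y ∧ Ψ.inn y = Sum.inr z ∧ compInn Φ Ψ x = Sum.inr z) := by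
  rcases h : (Φ.inn x : X.out ⊕ Y.inp) with x' | y
  · exact Or.inl ⟨x', rfl, compInn_inl Ψ h⟩
  · rcases h' : (Ψ.inn y : Y.out ⊕ Z.inp) with y' | z
    · exact Or.inr (Or.inl ⟨y, y', rfl, h', compInn_inr_inl h h'⟩)
    · exact Or.inr (Or.inr ⟨y, z, rfl, h', compInn_inr_inr h h'⟩)

/-- Composition of wiring diagrams, in diagrammatic order. -/
def comp (Φ : WD X Y) (Ψ : WD Y Z) : WD X Z :=
  ofPair (compInn Φ Ψ) (Φ.out.comp Ψ.out) (by
    apply bijective_of_card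
    · have h1 := Φ.card_eq
      have h2 := Ψ.card_eq
      omega
    · intro x x' h
      have f1 := @inn_inj _ _ Φ x x'
      have f2 := @inn_inj _ _ Ψ
      have f3 := @out_inj _ _ Φ
      have f4 := inn_ne_out Φ
      rcases compInn_cases Φ Ψ x with ⟨a, h1, h2⟩ | ⟨a, b, h1, h2, h3⟩ | ⟨a, b, h1, h2, h3⟩ <;>
      rcases compInn_cases Φ Ψ x' with ⟨c, k1, k2⟩ | ⟨c, d, k1, k2, k3⟩ | ⟨c, d, k1, k2, k3⟩ <;>
      grind
    · exact fun _ _ h => Ψ.out_inj (Φ.out_inj h)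
    · intro x z h
      have f2 := @inn_ne_out _ _ Ψ
      have f3 := @out_inj _ _ Φ
      have f4 := inn_ne_out Φ
      change _ = Sum.inl (Φ.out (Ψ.out z)) at h
      rcases compInn_cases Φ Ψ x with ⟨a, h1, h2⟩ | ⟨a, b, h1, h2, h3⟩ | ⟨a, b, h1, h2, h3⟩ <;>
      grind)

theorem inn_comp (Φ : WD X Y) (Ψ : WD Y Z) (x : X.inp) : (comp Φ Ψ).inn x = compInn Φ Ψ x := rfl

theorem out_comp (Φ : WD X Y) (Ψ : WD Y Z) (z : Z.out) :
    (comp Φ Ψ).out z = Φ.out (Ψ.out z) := rfl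

theorem compInn_eq (Φ : WD X Y) (Ψ : WD Y Z) (x : X.inp) :
    compInn Φ Ψ x = Sum.elim (fun x' => (Sum.inl x' : X.out ⊕ Z.inp))
      (fun y => Sum.elim (fun y' => Sum.inl (Φ.out y')) Sum.inr (Ψ.inn y : Y.out ⊕ Z.inp))
      (Φ.inn x : X.out ⊕ Y.inp) := by
  rcases compInn_cases Φ Ψ x with ⟨a, h1, h2⟩ | ⟨a, b, h1, h2, h3⟩ | ⟨a, b, h1, h2, h3⟩
  · rw [h1, h2]; rfl
  · rw [h1, h3, Sum.elim_inr, h2]; rfl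
  · rw [h1, h3, Sum.elim_inr, h2]; rfl

theorem id_comp (Φ : WD X Y) : comp (id X) Φ = Φ := by
  refine ext_pair (fun x => ?_) (fun _ => rfl)
  rw [inn_comp, compInn_eq]
  change Sum.elim _ _ (Φ.inn x : X.out ⊕ Y.inp) = _
  rcases (Φ.inn x : X.out ⊕ Y.inp) with _ | _ <;> rfl

theorem comp_id (Φ : WD X Y) : comp Φ (id Y) = Φ := by
  refine ext_pair (fun x => ?_) (fun _ => rfl)
  rw [inn_comp, compInn_eq]
  rcases (Φ.inn x : X.out ⊕ Y.inp) with _ | _ <;> rfl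

theorem comp_assoc {W : Box} (Φ : WD X Y) (Ψ : WD Y Z) (Θ : WD Z W) :
    comp (comp Φ Ψ) Θ = comp Φ (comp Ψ Θ) := by
  refine ext_pair (fun x => ?_) (fun _ => rfl)
  simp only [inn_comp, compInn_eq]
  rcases (Φ.inn x : X.out ⊕ Y.inp) with _ | y
  · rfl
  · simp only [Sum.elim_inr]
    rcases (Ψ.inn y : Y.out ⊕ Z.inp) with _ | z
    · rfl
    · simp only [Sum.elim_inr]
      rcases (Θ.inn z : Z.out ⊕ W.inp) with _ | _ <;> rfl

end WD

instance : Category Box where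
  Hom := WD
  id := WD.id
  comp := WD.comp
  id_comp := WD.id_comp
  comp_id := WD.comp_id
  assoc := WD.comp_assoc

namespace Box

/-- The monoidal product of boxes. -/
def tensor (X Y : Box) : Box := ⟨X.inp.sum Y.inp, X.out.sum Y.out⟩

/-- The closed box. -/
def closed : Box := ⟨TFS.empty, TFS.empty⟩

end Box

namespace WD

variable {X X' X'' Y Y' Y'' Z Z' : Box}

def tensorInn (Φ : WD X Y) (Φ' : WD X' Y') :
    TypedFun (X.inp.sum X'.inp) ((X.out.sum X'.out).sum (Y.inp.sum Y'.inp)) :=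
  (((TypedFun.inl X.out X'.out).map (TypedFun.inl Y.inp Y'.inp)).comp Φ.inn).elim
    (((TypedFun.inr X.out X'.out).map (TypedFun.inr Y.inp Y'.inp)).comp Φ'.inn)

theorem tensorInn_inl (Φ : WD X Y) (Φ' : WD X' Y') (x : X.inp) :
    tensorInn Φ Φ' (Sum.inl x) =
      Sum.map Sum.inl Sum.inl (Φ.inn x : X.out ⊕ Y.inp) := rfl

theorem tensorInn_inr (Φ : WD X Y) (Φ' : WD X' Y') (x : X'.inp) :
    tensorInn Φ Φ' (Sum.inr x) =
      Sum.map Sum.inr Sum.inr (Φ'.inn x : X'.out ⊕ Y'.inp) := rfl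

theorem map_inl_ne_map_inr {A A' B B' : Type} (u : A ⊕ B) (v : A' ⊕ B') :
    (Sum.map Sum.inl Sum.inl u : (A ⊕ A') ⊕ (B ⊕ B')) ≠ Sum.map Sum.inr Sum.inr v := by
  rcases u with _ | _ <;> rcases v with _ | _ <;> simp

/-- The monoidal product of wiring diagrams: the coproduct of the underlying typed bijections. -/
def tensor (Φ : WD X Y) (Φ' : WD X' Y') : WD (X.tensor X') (Y.tensor Y') :=
  ofPair (X := X.tensor X') (Y := Y.tensor Y') (tensorInn Φ Φ') (Φ.out.map Φ'.out) (by
    apply bijective_of_card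
    · have h1 := Φ.card_eq
      have h2 := Φ'.card_eq
      change Nat.card (X.inp ⊕ X'.inp) + Nat.card (Y.out ⊕ Y'.out) =
        Nat.card (X.out ⊕ X'.out) + Nat.card (Y.inp ⊕ Y'.inp)
      simp only [Nat.card_sum]
      omega
    · rintro (x | x) (x' | x') h
      · exact congrArg Sum.inl (Φ.inn_inj
          (Sum.map_injective.2 ⟨Sum.inl_injective, Sum.inl_injective⟩ h))
      · exact absurd h (map_inl_ne_map_inr (Φ.inn x) (Φ'.inn x'))
      · exact absurd h.symm (map_inl_ne_map_inr (Φ.inn x') (Φ'.inn x))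
      · exact congrArg Sum.inr (Φ'.inn_inj
          (Sum.map_injective.2 ⟨Sum.inr_injective, Sum.inr_injective⟩ h))
    · rintro (y | y) (y' | y') h
      · exact congrArg Sum.inl (Φ.out_inj (Sum.inl_injective h))
      · exact absurd h Sum.inl_ne_inr
      · exact absurd h Sum.inr_ne_inl
      · exact congrArg Sum.inr (Φ'.out_inj (Sum.inr_injective h))
    · rintro (x | x) (y | y) h
      · exact Φ.inn_ne_out x y (Sum.map_injective.2 ⟨Sum.inl_injective, Sum.inl_injective⟩ h)
      · exact map_inl_ne_map_inr (Φ.inn x) (Sum.inl (Φ'.out y) : X'.out ⊕ Y'.inp) h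
      · exact map_inl_ne_map_inr (Sum.inl (Φ.out y) : X.out ⊕ Y.inp) (Φ'.inn x) h.symm
      · exact Φ'.inn_ne_out x y (Sum.map_injective.2 ⟨Sum.inr_injective, Sum.inr_injective⟩ h))

/-- The wiring diagram given by typed bijections of the input ports and of the output ports. -/
def relabel (e : TypedFun X.inp Y.inp) (o : TypedFun Y.out X.out) (he : Function.Bijective e)
    (ho : Function.Bijective o) : WD X Y :=
  ofPair ((TypedFun.inr X.out Y.inp).comp e) o (bijective_of_card
    (by rw [Nat.card_congr (Equiv.ofBijective _ he), Nat.card_congr (Equiv.ofBijective _ ho),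
      add_comm])
    (fun _ _ h => he.1 (Sum.inr_injective h)) (fun _ _ h => ho.1 h) (fun _ _ => Sum.inr_ne_inl))

end WD

namespace TypedFun

variable (A B C : TFS)

theorem bijective_swap : Function.Bijective (swap A B) := (Equiv.sumComm A B).bijective

theorem bijective_assoc : Function.Bijective (assoc A B C) := by
  have h : (assoc A B C).toFun = Equiv.sumAssoc A B C := by
    funext x; rcases x with (_ | _) | _ <;> rfl
  rw [h]; exact (Equiv.sumAssoc A B C).bijective

theorem bijective_assocInv : Function.Bijective (assocInv A B C) := by
  have h : (assocInv A B C).toFun = (Equiv.sumAssoc A B C).symm := by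
    funext x; rcases x with _ | _ | _ <;> rfl
  rw [h]; exact (Equiv.sumAssoc A B C).symm.bijective

def emptySum : TypedFun (TFS.empty.sum A) A := (fromEmpty A).elim (id A)

def sumEmpty : TypedFun (A.sum TFS.empty) A := (id A).elim (fromEmpty A)

theorem bijective_emptySum : Function.Bijective (emptySum A) := by
  constructor
  · rintro (⟨⟨⟩⟩ | x) (⟨⟨⟩⟩ | y) h; exact congrArg Sum.inr h
  · exact fun a => ⟨Sum.inr a, rfl⟩

theorem bijective_sumEmpty : Function.Bijective (sumEmpty A) := by
  constructor
  · rintro (x | ⟨⟨⟩⟩) (y | ⟨⟨⟩⟩) h; exact congrArg Sum.inl h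
  · exact fun a => ⟨Sum.inl a, rfl⟩

theorem bijective_inr_empty : Function.Bijective (inr TFS.empty A) :=
  ⟨Sum.inr_injective, by rintro (⟨⟨⟩⟩ | x); exact ⟨x, rfl⟩⟩

theorem bijective_inl_empty : Function.Bijective (inl A TFS.empty) :=
  ⟨Sum.inl_injective, by rintro (x | ⟨⟨⟩⟩); exact ⟨x, rfl⟩⟩

end TypedFun

open TypedFun in
instance : MonoidalCategoryStruct Box where
  tensorObj := Box.tensor
  tensorUnit := Box.closed
  tensorHom Φ Φ' := WD.tensor Φ Φ'
  whiskerLeft X _ _ Φ := WD.tensor (WD.id X) Φ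
  whiskerRight Φ X := WD.tensor Φ (WD.id X)
  associator X Y Z :=
    { hom := WD.relabel (X := (X.tensor Y).tensor Z) (Y := X.tensor (Y.tensor Z))
        (assoc X.inp Y.inp Z.inp) (assocInv X.out Y.out Z.out)
        (bijective_assoc _ _ _) (bijective_assocInv _ _ _)
      inv := WD.relabel (X := X.tensor (Y.tensor Z)) (Y := (X.tensor Y).tensor Z)
        (assocInv X.inp Y.inp Z.inp) (assoc X.out Y.out Z.out)
        (bijective_assocInv _ _ _) (bijective_assoc _ _ _)
      hom_inv_id := WD.ext_pair (by rintro ((_ | _) | _) <;> rfl) (by rintro ((_ | _) | _) <;> rfl)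
      inv_hom_id := WD.ext_pair (by rintro (_ | _ | _) <;> rfl) (by rintro (_ | _ | _) <;> rfl) }
  leftUnitor X :=
    { hom := WD.relabel (X := Box.closed.tensor X) (Y := X) (emptySum X.inp)
        (inr TFS.empty X.out) (bijective_emptySum _) (bijective_inr_empty _)
      inv := WD.relabel (X := X) (Y := Box.closed.tensor X) (inr TFS.empty X.inp)
        (emptySum X.out) (bijective_inr_empty _) (bijective_emptySum _)
      hom_inv_id := WD.ext_pair (by rintro (⟨⟨⟩⟩ | _); rfl) (by rintro (⟨⟨⟩⟩ | _); rfl)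
      inv_hom_id := WD.ext_pair (fun _ => rfl) (fun _ => rfl) }
  rightUnitor X :=
    { hom := WD.relabel (X := X.tensor Box.closed) (Y := X) (sumEmpty X.inp)
        (inl X.out TFS.empty) (bijective_sumEmpty _) (bijective_inl_empty _)
      inv := WD.relabel (X := X) (Y := X.tensor Box.closed) (inl X.inp TFS.empty)
        (sumEmpty X.out) (bijective_inl_empty _) (bijective_sumEmpty _)
      hom_inv_id := WD.ext_pair (by rintro (_ | ⟨⟨⟩⟩); rfl) (by rintro (_ | ⟨⟨⟩⟩); rfl)
      inv_hom_id := WD.ext_pair (fun _ => rfl) (fun _ => rfl) }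

namespace WD

variable {X X' X'' Y Y' Y'' Z Z' : Box}

theorem tensor_id (X Y : Box) : tensor (id X) (id Y) = id (X.tensor Y) :=
  ext_pair (by rintro (_ | _) <;> rfl) (by rintro (_ | _) <;> rfl)

theorem tensor_comp (Φ : WD X Y) (Φ' : WD X' Y') (Ψ : WD Y Z) (Ψ' : WD Y' Z') :
    comp (tensor Φ Φ') (tensor Ψ Ψ') = tensor (comp Φ Ψ) (comp Φ' Ψ') := by
  refine ext_pair ?_ (by rintro (_ | _) <;> rfl)
  rintro (x | x)
  · refine (compInn_eq _ _ _).trans ?_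
    refine Eq.trans ?_ (congrArg (Sum.map Sum.inl Sum.inl) (compInn_eq Φ Ψ x)).symm
    change Sum.elim _ _ (Sum.map Sum.inl Sum.inl (Φ.inn x : X.out ⊕ Y.inp)) = _
    rcases (Φ.inn x : X.out ⊕ Y.inp) with _ | y
    · rfl
    · change Sum.elim _ _ (Sum.map Sum.inl Sum.inl (Ψ.inn y : Y.out ⊕ Z.inp)) = 
        Sum.map _ _ (Sum.elim _ _ (Ψ.inn y : Y.out ⊕ Z.inp))
      rcases (Ψ.inn y : Y.out ⊕ Z.inp) with _ | _ <;> rfl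
  · refine (compInn_eq _ _ _).trans ?_
    refine Eq.trans ?_ (congrArg (Sum.map Sum.inr Sum.inr) (compInn_eq Φ' Ψ' x)).symm
    change Sum.elim _ _ (Sum.map Sum.inr Sum.inr (Φ'.inn x : X'.out ⊕ Y'.inp)) = _
    rcases (Φ'.inn x : X'.out ⊕ Y'.inp) with _ | y
    · rfl
    · change Sum.elim _ _ (Sum.map Sum.inr Sum.inr (Ψ'.inn y : Y'.out ⊕ Z'.inp)) =
        Sum.map _ _ (Sum.elim _ _ (Ψ'.inn y : Y'.out ⊕ Z'.inp))
      rcases (Ψ'.inn y : Y'.out ⊕ Z'.inp) with _ | _ <;> rfl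

theorem comp_relabel (Φ : WD X Y) (e : TypedFun Y.inp Z.inp) (o : TypedFun Z.out Y.out)
    (he : Function.Bijective e) (ho : Function.Bijective o) (x : X.inp) :
    (comp Φ (relabel e o he ho)).inn x =
      (Sum.map (fun a => a) e (Φ.inn x : X.out ⊕ Y.inp) : X.out ⊕ Z.inp) := by
  refine (compInn_eq _ _ _).trans ?_
  rcases (Φ.inn x : X.out ⊕ Y.inp) with _ | _ <;> rfl

theorem relabel_comp (Φ : WD Y Z) (e : TypedFun X.inp Y.inp) (o : TypedFun Y.out X.out)
    (he : Function.Bijective e) (ho : Function.Bijective o) (x : X.inp) :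
    (comp (relabel e o he ho) Φ).inn x =
      (Sum.map o (fun a => a) (Φ.inn (e x) : Y.out ⊕ Z.inp) : X.out ⊕ Z.inp) := by
  refine (compInn_eq (relabel e o he ho) Φ x).trans ?_
  change Sum.elim _ _ (Φ.inn (e x) : Y.out ⊕ Z.inp) = _
  rcases (Φ.inn (e x) : Y.out ⊕ Z.inp) with _ | _ <;> rfl

end WD

instance : MonoidalCategory Box := MonoidalCategory.ofTensorHom
  (id_tensorHom_id := WD.tensor_id)
  (id_tensorHom := fun _ _ _ _ => rfl)
  (tensorHom_id := fun _ _ => rfl)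
  (tensorHom_comp_tensorHom := fun Φ Φ' Ψ Ψ' => WD.tensor_comp Φ Φ' Ψ Ψ')
  (associator_naturality := fun {X₁ X₂ X₃ Y₁ Y₂ Y₃} Φ₁ Φ₂ Φ₃ => by
    refine WD.ext_pair ?_ (by rintro (_ | _ | _) <;> rfl)
    intro x
    refine (WD.comp_relabel _ _ _ (TypedFun.bijective_assoc _ _ _)
      (TypedFun.bijective_assocInv _ _ _) x).trans (Eq.trans ?_ (WD.relabel_comp _ _ _
        (TypedFun.bijective_assoc _ _ _) (TypedFun.bijective_assocInv _ _ _) x).symm)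
    rcases x with (x | x) | x
    · change Sum.map _ _ (Sum.map Sum.inl Sum.inl (Sum.map Sum.inl Sum.inl
        (WD.inn Φ₁ x : X₁.out ⊕ Y₁.inp))) =
        Sum.map _ _ (Sum.map Sum.inl Sum.inl (WD.inn Φ₁ x : X₁.out ⊕ Y₁.inp))
      rcases (WD.inn Φ₁ x : X₁.out ⊕ Y₁.inp) with _ | _ <;> rfl
    · change Sum.map _ _ (Sum.map Sum.inl Sum.inl (Sum.map Sum.inr Sum.inr
        (WD.inn Φ₂ x : X₂.out ⊕ Y₂.inp))) =
        Sum.map _ _ (Sum.map Sum.inr Sum.inr (Sum.map Sum.inl Sum.inl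
        (WD.inn Φ₂ x : X₂.out ⊕ Y₂.inp)))
      rcases (WD.inn Φ₂ x : X₂.out ⊕ Y₂.inp) with _ | _ <;> rfl
    · change Sum.map _ _ (Sum.map Sum.inr Sum.inr (WD.inn Φ₃ x : X₃.out ⊕ Y₃.inp)) =
        Sum.map _ _ (Sum.map Sum.inr Sum.inr (Sum.map Sum.inr Sum.inr
        (WD.inn Φ₃ x : X₃.out ⊕ Y₃.inp)))
      rcases (WD.inn Φ₃ x : X₃.out ⊕ Y₃.inp) with _ | _ <;> rfl)
  (leftUnitor_naturality := fun {X Y} Φ => by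
    refine WD.ext_pair ?_ (fun _ => rfl)
    rintro (⟨⟨⟩⟩ | x)
    refine (WD.comp_relabel _ _ _ (TypedFun.bijective_emptySum _) (TypedFun.bijective_inr_empty _) _).trans
      (Eq.trans ?_ (WD.relabel_comp _ _ _ (TypedFun.bijective_emptySum _) (TypedFun.bijective_inr_empty _)
        _).symm)
    change Sum.map _ _ (Sum.map Sum.inr Sum.inr (WD.inn Φ x : X.out ⊕ Y.inp)) =
      Sum.map _ _ (WD.inn Φ x : X.out ⊕ Y.inp)
    rcases (WD.inn Φ x : X.out ⊕ Y.inp) with _ | _ <;> rfl)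
  (rightUnitor_naturality := fun {X Y} Φ => by
    refine WD.ext_pair ?_ (fun _ => rfl)
    rintro (x | ⟨⟨⟩⟩)
    refine (WD.comp_relabel _ _ _ (TypedFun.bijective_sumEmpty _) (TypedFun.bijective_inl_empty _) _).trans
      (Eq.trans ?_ (WD.relabel_comp _ _ _ (TypedFun.bijective_sumEmpty _) (TypedFun.bijective_inl_empty _)
        _).symm)
    change Sum.map _ _ (Sum.map Sum.inl Sum.inl (WD.inn Φ x : X.out ⊕ Y.inp)) =
      Sum.map _ _ (WD.inn Φ x : X.out ⊕ Y.inp)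
    rcases (WD.inn Φ x : X.out ⊕ Y.inp) with _ | _ <;> rfl)
  (pentagon := fun _ _ _ _ => WD.ext_pair (by rintro (((_ | _) | _) | _) <;> rfl)
    (by rintro (_ | _ | _ | _) <;> rfl))
  (triangle := fun _ _ => WD.ext_pair (by rintro ((_ | ⟨⟨⟩⟩) | _) <;> rfl)
    (by rintro (_ | _) <;> rfl))

/-- Exchange of the two summands. -/
def Box.braid (X Y : Box) : X ⊗ Y ≅ Y ⊗ X where
  hom := WD.relabel (X := X.tensor Y) (Y := Y.tensor X) (TypedFun.swap X.inp Y.inp)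
    (TypedFun.swap Y.out X.out) (TypedFun.bijective_swap _ _) (TypedFun.bijective_swap _ _)
  inv := WD.relabel (X := Y.tensor X) (Y := X.tensor Y) (TypedFun.swap Y.inp X.inp)
    (TypedFun.swap X.out Y.out) (TypedFun.bijective_swap _ _) (TypedFun.bijective_swap _ _)
  hom_inv_id := WD.ext_pair (by rintro (_ | _) <;> rfl) (by rintro (_ | _) <;> rfl)
  inv_hom_id := WD.ext_pair (by rintro (_ | _) <;> rfl) (by rintro (_ | _) <;> rfl)

theorem WD.tensor_braid {X X' Y Y' : Box} (Φ : X ⟶ Y) (Φ' : X' ⟶ Y') :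
    (Φ ⊗ₘ Φ') ≫ (Box.braid Y Y').hom = (Box.braid X X').hom ≫ (Φ' ⊗ₘ Φ) := by
  refine WD.ext_pair ?_ (by rintro (_ | _) <;> rfl)
  intro x
  refine (WD.comp_relabel _ _ _ (TypedFun.bijective_swap _ _)
    (TypedFun.bijective_swap _ _) x).trans (Eq.trans ?_ (WD.relabel_comp _ _ _
      (TypedFun.bijective_swap _ _) (TypedFun.bijective_swap _ _) x).symm)
  rcases x with x | x
  · change Sum.map _ _ (Sum.map Sum.inl Sum.inl (WD.inn Φ x : X.out ⊕ Y.inp)) =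
      Sum.map _ _ (Sum.map Sum.inr Sum.inr (WD.inn Φ x : X.out ⊕ Y.inp))
    rcases (WD.inn Φ x : X.out ⊕ Y.inp) with _ | _ <;> rfl
  · change Sum.map _ _ (Sum.map Sum.inr Sum.inr (WD.inn Φ' x : X'.out ⊕ Y'.inp)) =
      Sum.map _ _ (Sum.map Sum.inl Sum.inl (WD.inn Φ' x : X'.out ⊕ Y'.inp))
    rcases (WD.inn Φ' x : X'.out ⊕ Y'.inp) with _ | _ <;> rfl

instance : SymmetricCategory Box where
  braiding := Box.braid
  braiding_naturality_right X _ _ Φ := WD.tensor_braid (𝟙 X) Φ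
  braiding_naturality_left Φ X := WD.tensor_braid Φ (𝟙 X)
  hexagon_forward _ _ _ := WD.ext_pair (by rintro ((_ | _) | _) <;> rfl)
    (by rintro (_ | _ | _) <;> rfl)
  hexagon_reverse _ _ _ := WD.ext_pair (by rintro (_ | _ | _) <;> rfl)
    (by rintro ((_ | _) | _) <;> rfl)
  symmetry X Y := (Box.braid X Y).hom_inv_id

/-! ### Open dynamical systems -/

/-- Open dynamical systems with state space `M`, input space `U` and output space `V`. -/
@[ext]
structure OpenSystem (M U V : Man) where
  /-- The differential equation. -/
  eqn : M.prod U → TangentBundle M.I M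
  /-- The readout map. -/
  readout : M → V
  smooth_eqn : ContMDiff (M.prod U).I M.I.tangent ∞ eqn
  smooth_readout : IsSmooth readout
  proj_eqn : ∀ p : M.prod U, (eqn p).proj = p.1

namespace OpenSystem

/-- `(ζM, ζU, ζV)` is a morphism of open systems from `f` to `g`. -/
structure IsMorphism {M U V M' U' V' : Man} (f : OpenSystem M U V) (g : OpenSystem M' U' V')
    (ζM : M → M') (ζU : U → U') (ζV : V → V') : Prop where
  smooth_state : IsSmooth ζM
  smooth_input : IsSmooth ζU
  smooth_output : IsSmooth ζV
  eqn_comm : ∀ m u, tangentMap M.I M'.I ζM (f.eqn (m, u)) = g.eqn (ζM m, ζU u)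
  readout_comm : ∀ m, ζV (f.readout m) = g.readout (ζM m)

/-- The product of two open systems. -/
def prod {M U V M' U' V' : Man} (f : OpenSystem M U V) (g : OpenSystem M' U' V') :
    OpenSystem (M.prod M') (U.prod U') (V.prod V') where
  eqn p := (equivTangentBundleProd M.I M M'.I M').symm
    (f.eqn (p.1.1, p.2.1), g.eqn (p.1.2, p.2.2))
  readout m := (f.readout m.1, g.readout m.2)
  smooth_eqn := by
    have h1 := Man.isSmooth_fst (M.prod M') (U.prod U')
    have h2 := Man.isSmooth_snd (M.prod M') (U.prod U')
    have a := Man.isSmooth_prodMk (Man.isSmooth_comp (Man.isSmooth_fst M M') h1)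
      (Man.isSmooth_comp (Man.isSmooth_fst U U') h2)
    have b := Man.isSmooth_prodMk (Man.isSmooth_comp (Man.isSmooth_snd M M') h1)
      (Man.isSmooth_comp (Man.isSmooth_snd U U') h2)
    exact contMDiff_equivTangentBundleProd_symm.comp
      ((f.smooth_eqn.comp a).prodMk (g.smooth_eqn.comp b))
  smooth_readout := Man.isSmooth_prodMk
    (Man.isSmooth_comp f.smooth_readout (Man.isSmooth_fst M M'))
    (Man.isSmooth_comp g.smooth_readout (Man.isSmooth_snd M M'))
  proj_eqn p := Prod.ext (f.proj_eqn _) (g.proj_eqn _)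

/-- Transport of an open system along diffeomorphisms of its state, input and output spaces. -/
def transport {M U V M' U' V' : Man} (f : OpenSystem M U V) (eM : M ≃ₘ⟮M.I, M'.I⟯ M')
    (eU : U ≃ₘ⟮U.I, U'.I⟯ U') (eV : V ≃ₘ⟮V.I, V'.I⟯ V') : OpenSystem M' U' V' where
  eqn p := tangentMap M.I M'.I eM (f.eqn (eM.symm p.1, eU.symm p.2))
  readout m := eV (f.readout (eM.symm m))
  smooth_eqn := by
    have h1 : IsSmooth fun p : M'.prod U' => eM.symm p.1 :=
      Man.isSmooth_comp eM.symm.contMDiff (Man.isSmooth_fst M' U')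
    have h2 : IsSmooth fun p : M'.prod U' => eU.symm p.2 :=
      Man.isSmooth_comp eU.symm.contMDiff (Man.isSmooth_snd M' U')
    exact (eM.contMDiff.contMDiff_tangentMap le_rfl).comp
      (f.smooth_eqn.comp (Man.isSmooth_prodMk h1 h2))
  smooth_readout := Man.isSmooth_comp eV.contMDiff
    (Man.isSmooth_comp f.smooth_readout eM.symm.contMDiff)
  proj_eqn p := by
    have h := f.proj_eqn (eM.symm p.1, eU.symm p.2)
    exact (congrArg eM h).trans (eM.apply_symm_apply p.1)

end OpenSystem

/-! ### Open systems on a box -/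

/-- The open systems on the box `X`: a typed finite set of state variables together with an open
system on its dependent product. -/
structure Sys (X : Box) : Type 1 where
  S : TFS
  f : OpenSystem S.dprod X.inp.dprod X.out.dprod

namespace Sys

/-- The open system on the outer box of a wiring diagram obtained from one on the inner box, by
feeding outputs back into inputs. -/
def map {X Y : Box} (Φ : X ⟶ Y) (x : Sys X) : Sys Y where
  S := x.S
  f :=
    { eqn := fun p => x.f.eqn (p.1,
        (WD.inn Φ).dprod ((TFS.dprodSum X.out Y.inp).symm (x.f.readout p.1, p.2)))
      readout := fun s => (WD.out Φ).dprod (x.f.readout s)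
      smooth_eqn := by
        have h1 := Man.isSmooth_fst x.S.dprod Y.inp.dprod
        have h2 := Man.isSmooth_prodMk (Man.isSmooth_comp x.f.smooth_readout h1)
          (Man.isSmooth_snd x.S.dprod Y.inp.dprod)
        exact x.f.smooth_eqn.comp (Man.isSmooth_prodMk h1
          (Man.isSmooth_comp (TypedFun.isSmooth_dprod (WD.inn Φ))
            (Man.isSmooth_comp (TFS.dprodSum X.out Y.inp).symm.contMDiff h2)))
      smooth_readout :=
        Man.isSmooth_comp (TypedFun.isSmooth_dprod (WD.out Φ)) x.f.smooth_readout
      proj_eqn := fun p => x.f.proj_eqn _ }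

/-- The coherence map: the product of two open systems, on the coproduct of the sets of state
variables. -/
def mu {X Y : Box} (x : Sys X) (y : Sys Y) : Sys (X ⊗ Y) where
  S := x.S.sum y.S
  f := (x.f.prod y.f).transport (TFS.dprodSum x.S y.S).symm (TFS.dprodSum X.inp Y.inp).symm
    (TFS.dprodSum X.out Y.out).symm

/-- The open system on the closed box without state variables. -/
def unit : Sys (𝟙_ Box) where
  S := TFS.empty
  f :=
    { eqn := fun p => ⟨p.1, 0⟩
      readout := fun s => s
      smooth_eqn := by
        exact (Bundle.contMDiff_zeroSection ℝ (TangentSpace TFS.empty.dprod.I)).comp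
          (Man.isSmooth_fst TFS.empty.dprod TFS.empty.dprod)
      smooth_readout := Man.isSmooth_id TFS.empty.dprod
      proj_eqn := fun _ => rfl }

/-- `σ` is a renaming of the state variables of `x` that turns `x` into `y`: a typed bijection
whose dependent product, together with the identities of the input and the output space, is a
morphism of open systems. -/
def IsRenaming {X : Box} (x y : Sys X) (σ : TypedFun x.S y.S) : Prop :=
  Function.Bijective σ ∧ y.f.IsMorphism x.f σ.dprod (fun u => u) (fun v => v)

end Sys

/-- The assignment `X ↦ Sys X`, `Φ ↦ Sys.map Φ` as a functor, once the functor laws are known. -/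
def functorG (map_id : ∀ (X : Box) (x : Sys X), x.map (𝟙 X) = x)
    (map_comp : ∀ {X Y Z : Box} (Φ : X ⟶ Y) (Ψ : Y ⟶ Z) (x : Sys X),
      x.map (Φ ≫ Ψ) = (x.map Φ).map Ψ) : Box ⥤ Type 1 where
  obj X := Sys X
  map Φ := ↾(Sys.map Φ)
  map_id X := by ext x; exact map_id X x
  map_comp Φ Ψ := by ext x; exact map_comp Φ Ψ x

end OpenDyn

end

open CategoryTheory MonoidalCategory OpenDyn

noncomputable section

/-! Both wiring and products act on open systems port by port, so every claim is reduced to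
coordinates.

For input signals, `feed` copies to each inner input port the value found at the other end of its
wire, an inner output or an outer input. Following a wire through a composite gives `feed_comp`,
hence functoriality; following it through a tensor gives `inl_feed_tensor` and `inr_feed_tensor`,
since wires stay inside their own summand.

For vector fields, a tangent vector to the dependent product of a coproduct is determined by its
images under the two restriction maps (`tangent_sum_ext`), and for `Sys.mu` these images are the
equations of the factors (`tangent_inl_mu_eqn`, `tangent_inr_mu_eqn`). Naturality in `map_mu` and
the coherence renamings thus become identities on each summand, where the chain rule reduces them to
equations between typed functions, mostly definitional.

Renamings contain identities, compose, invert, and are preserved by `Sys.map` and by `Sys.mu`. Hence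
both operations descend to classes, and coherence up to renaming becomes strict equality, which
makes the quotient functor lax symmetric monoidal. -/

namespace OpenDyn

/-! ### Tangent maps and products of manifolds -/

/-- The tangent map of a map between manifolds. -/
def Man.tangent {M N : Man} (f : M → N) (v : TangentBundle M.I M) : TangentBundle N.I N :=
  tangentMap M.I N.I f v

theorem Man.tangent_comp {L M N : Man} {g : M → N} {f : L → M} (hg : IsSmooth g)
    (hf : IsSmooth f) (v : TangentBundle L.I L) :
    Man.tangent (fun x => g (f x)) v = Man.tangent g (Man.tangent f v) :=
  tangentMap_comp_at v (ContMDiff.mdifferentiable hg (by simp) _)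
    (ContMDiff.mdifferentiable hf (by simp) _)

theorem Man.tangent_of_eq_id {M : Man} {f : M → M} (h : ∀ x, f x = x)
    (v : TangentBundle M.I M) : Man.tangent f v = v := by
  obtain rfl : f = id := funext h
  exact congrFun tangentMap_id v

/-- Expresses the splitting of the tangent bundle of a product through tangent maps of the
projections, so that the chain rule can compute its components. -/
theorem Man.equivTangentBundleProd_apply {M N : Man}
    (v : TangentBundle (M.prod N).I (M.prod N)) :
    equivTangentBundleProd M.I M N.I N v =
      (Man.tangent (M := M.prod N) (N := M) Prod.fst v,
        Man.tangent (M := M.prod N) (N := N) Prod.snd v) :=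
  congrFun equivTangentBundleProd_eq_tangentMap_prod_tangentMap v

/-! ### Dependent products and their tangent bundles -/

namespace TypedFun

variable {A B C D : TFS}

/-- The manifolds at `a` and at `q a` are equal only propositionally, hence the cast in `dprod`.
Heterogeneous equality absorbs it, so values can be followed along several wires by transitivity. -/
theorem dprod_heq (q : TypedFun A B) (x : B.dprod) {a : A} {b : B} (h : q a = b) :
    HEq (q.dprod x a) (x b) := by
  subst h
  exact cast_heq _ _

theorem dprod_comp (q : TypedFun B C) (r : TypedFun A B) (x : C.dprod) :
    (q.comp r).dprod x = r.dprod (q.dprod x) := by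
  funext a
  exact (cast_cast _ _ _).symm

/-- The tangent map of the map of dependent products induced by a typed function. -/
def tangent (q : TypedFun A B) (v : TangentBundle B.dprod.I B.dprod) :
    TangentBundle A.dprod.I A.dprod :=
  Man.tangent q.dprod v

theorem tangent_comp (q : TypedFun B C) (r : TypedFun A B)
    (v : TangentBundle C.dprod.I C.dprod) :
    (q.comp r).tangent v = r.tangent (q.tangent v) := by
  have h : (q.comp r).dprod = fun x => r.dprod (q.dprod x) := funext (dprod_comp q r)
  rw [tangent, h]
  exact Man.tangent_comp r.isSmooth_dprod q.isSmooth_dprod v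

theorem tangent_id (v : TangentBundle A.dprod.I A.dprod) : (id A).tangent v = v :=
  Man.tangent_of_eq_id (fun _ => rfl) v

/-- The inverse of a bijective typed function. -/
def inverse (q : TypedFun A B) (h : Function.Bijective q) : TypedFun B A where
  toFun := (Equiv.ofBijective _ h).symm
  typed b := by
    rw [← q.typed]
    exact congrArg B.type ((Equiv.ofBijective _ h).apply_symm_apply b)

theorem comp_inverse (q : TypedFun A B) (h : Function.Bijective q) :
    q.comp (q.inverse h) = id B := by
  ext b
  exact (Equiv.ofBijective _ h).apply_symm_apply b

theorem inverse_comp (q : TypedFun A B) (h : Function.Bijective q) :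
    (q.inverse h).comp q = id A := by
  ext a
  exact (Equiv.ofBijective _ h).symm_apply_apply a

theorem bijective_inverse (q : TypedFun A B) (h : Function.Bijective q) :
    Function.Bijective (q.inverse h) :=
  (Equiv.ofBijective _ h).symm.bijective

theorem bijective_map {f : TypedFun A C} {g : TypedFun B D} (hf : Function.Bijective f)
    (hg : Function.Bijective g) : Function.Bijective (f.map g) := by
  have h : (f.map g).toFun = Sum.map f g := by
    funext x; rcases x with _ | _ <;> rfl
  rw [h]
  exact Sum.map_bijective.2 ⟨hf, hg⟩

/-- The two projections of `dprodSum` are definitionally the maps induced by `inl` and `inr`, so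
this is the chain rule for each of them. -/
theorem tangent_dprodSum (v : TangentBundle (A.sum B).dprod.I (A.sum B).dprod) :
    equivTangentBundleProd A.dprod.I A.dprod B.dprod.I B.dprod
      (Man.tangent (M := (A.sum B).dprod) (N := A.dprod.prod B.dprod) (TFS.dprodSum A B) v) =
    ((inl A B).tangent v, (inr A B).tangent v) :=
  (Man.equivTangentBundleProd_apply _).trans (Prod.ext
    (Man.tangent_comp (Man.isSmooth_fst A.dprod B.dprod) (TFS.dprodSum A B).contMDiff v).symm
    (Man.tangent_comp (Man.isSmooth_snd A.dprod B.dprod) (TFS.dprodSum A B).contMDiff v).symm)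

/-- The tangent map of `dprodSum` has a left inverse, the tangent map of the inverse diffeomorphism,
and the target tangent bundle splits as a product. Equality of vectors can therefore be tested on
the two summands. -/
theorem tangent_sum_ext {v w : TangentBundle (A.sum B).dprod.I (A.sum B).dprod}
    (hl : (inl A B).tangent v = (inl A B).tangent w)
    (hr : (inr A B).tangent v = (inr A B).tangent w) : v = w := by
  have inv : ∀ v : TangentBundle (A.sum B).dprod.I (A.sum B).dprod,
      Man.tangent (M := A.dprod.prod B.dprod) (N := (A.sum B).dprod) (TFS.dprodSum A B).symm
        (Man.tangent (M := (A.sum B).dprod) (N := A.dprod.prod B.dprod)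
          (TFS.dprodSum A B) v) = v :=
    fun v => (Man.tangent_comp (TFS.dprodSum A B).symm.contMDiff
      (TFS.dprodSum A B).contMDiff v).symm.trans
        (Man.tangent_of_eq_id (TFS.dprodSum A B).symm_apply_apply v)
  have h := (equivTangentBundleProd A.dprod.I A.dprod B.dprod.I B.dprod).injective
    ((tangent_dprodSum v).trans ((Prod.ext hl hr).trans (tangent_dprodSum w).symm))
  exact (inv v).symm.trans ((congrArg _ h).trans (inv w))

/-- The base point and the vector are both functions on the empty type, so this tangent bundle has
at most one point. This settles the unit summand in the unit laws. -/
theorem tangent_empty_ext (v w : TangentBundle TFS.empty.dprod.I TFS.empty.dprod) : v = w := by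
  obtain ⟨p, v⟩ := v
  obtain ⟨q, w⟩ := w
  obtain rfl : p = q := funext fun a => a.elim
  exact congrArg _ (funext fun a => a.elim)

/-- Restricting along `inl` after the inverse of `dprodSum` is the first projection by definition;
the chain rule then leaves the first component of a split vector. -/
theorem tangent_inl_dprodSum_symm (v : TangentBundle A.dprod.I A.dprod)
    (w : TangentBundle B.dprod.I B.dprod) :
    (inl A B).tangent (Man.tangent (M := A.dprod.prod B.dprod) (TFS.dprodSum A B).symm
      ((equivTangentBundleProd A.dprod.I A.dprod B.dprod.I B.dprod).symm (v, w))) = v :=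
  (Man.tangent_comp (inl A B).isSmooth_dprod (TFS.dprodSum A B).symm.contMDiff _).symm.trans
    (congrArg Prod.fst ((Man.equivTangentBundleProd_apply _).symm.trans
      ((equivTangentBundleProd A.dprod.I A.dprod B.dprod.I B.dprod).apply_symm_apply (v, w))))

theorem tangent_inr_dprodSum_symm (v : TangentBundle A.dprod.I A.dprod)
    (w : TangentBundle B.dprod.I B.dprod) :
    (inr A B).tangent (Man.tangent (M := A.dprod.prod B.dprod) (TFS.dprodSum A B).symm
      ((equivTangentBundleProd A.dprod.I A.dprod B.dprod.I B.dprod).symm (v, w))) = w :=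
  (Man.tangent_comp (inr A B).isSmooth_dprod (TFS.dprodSum A B).symm.contMDiff _).symm.trans
    (congrArg Prod.snd ((Man.equivTangentBundleProd_apply _).symm.trans
      ((equivTangentBundleProd A.dprod.I A.dprod B.dprod.I B.dprod).apply_symm_apply (v, w))))

end TypedFun

/-! ### Functoriality: signals along composite wiring diagrams -/

namespace Sys

variable {X Y Z X' Y' : Box}

/-- Wiring never changes the set of state variables, so the strict laws compare systems over the
same `S` and no transport between state spaces arises. -/
theorem ext_of_S {S : TFS} {f g : OpenSystem S.dprod X.inp.dprod X.out.dprod}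
    (he : ∀ s u, f.eqn (s, u) = g.eqn (s, u)) (hr : ∀ s, f.readout s = g.readout s) :
    (⟨S, f⟩ : Sys X) = ⟨S, g⟩ :=
  congrArg (Sys.mk S) (OpenSystem.ext (funext fun p => he p.1 p.2) (funext hr))

/-- The identity diagram sends an input port to the outer copy of itself, so the fed signal is the
outer input, up to a cast along a reflexive equation, which reduces. -/
theorem map_id (x : Sys X) : x.map (𝟙 X) = x := rfl

/-- The signal fed into the inner box of a wiring diagram. -/
def feed (Φ : X ⟶ Y) (v : X.out.dprod) (u : Y.inp.dprod) : X.inp.dprod :=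
  (WD.inn Φ).dprod ((TFS.dprodSum X.out Y.inp).symm (v, u))

theorem feed_inl (Φ : X ⟶ Y) (v : X.out.dprod) (u : Y.inp.dprod) {a : X.inp} {b : X.out}
    (h : WD.inn Φ a = Sum.inl b) : HEq (feed Φ v u a) (v b) :=
  (WD.inn Φ).dprod_heq _ h

theorem feed_inr (Φ : X ⟶ Y) (v : X.out.dprod) (u : Y.inp.dprod) {a : X.inp} {b : Y.inp}
    (h : WD.inn Φ a = Sum.inr b) : HEq (feed Φ v u a) (u b) :=
  (WD.inn Φ).dprod_heq _ h

/-- An inner input is wired to an inner output, or to a middle input that is itself wired either to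
a middle output or to an outer input. In the second case the middle output is the inner output
chosen by `WD.out Φ`, which is why the middle box sees `(WD.out Φ).dprod v`. -/
theorem feed_comp (Φ : X ⟶ Y) (Ψ : Y ⟶ Z) (v : X.out.dprod) (u : Z.inp.dprod) :
    feed (Φ ≫ Ψ) v u = feed Φ v (feed Ψ ((WD.out Φ).dprod v) u) := by
  funext a
  apply eq_of_heq
  rcases WD.compInn_cases Φ Ψ a with ⟨b, h1, h2⟩ | ⟨b, c, h1, h2, h3⟩ | ⟨b, c, h1, h2, h3⟩
  · exact (feed_inl (Φ ≫ Ψ) v u h2).trans (feed_inl Φ _ _ h1).symm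
  · exact (feed_inl (Φ ≫ Ψ) v u h3).trans (((WD.out Φ).dprod_heq v rfl).symm.trans
      ((feed_inl Ψ _ _ h2).symm.trans (feed_inr Φ _ _ h1).symm))
  · exact (feed_inr (Φ ≫ Ψ) v u h3).trans
      ((feed_inr Ψ _ _ h2).symm.trans (feed_inr Φ _ _ h1).symm)

theorem map_comp (Φ : X ⟶ Y) (Ψ : Y ⟶ Z) (x : Sys X) :
    x.map (Φ ≫ Ψ) = (x.map Φ).map Ψ := by
  refine ext_of_S (fun s u => ?_) (fun s => ?_)
  · exact congrArg (fun w => x.f.eqn (s, w)) (feed_comp Φ Ψ _ u)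
  · exact (WD.out Φ).dprod_comp (WD.out Ψ) _

/-! ### Naturality of the product of systems -/

open TypedFun

/-- The product equation is transported along the inverse of `dprodSum`, so restricting to the first
summand recovers the first factor, evaluated at the restricted state and input. Together with
`tangent_sum_ext` this characterises the equation of `mu`. -/
theorem tangent_inl_mu_eqn (x : Sys X) (y : Sys Y) (s : (x.S.sum y.S).dprod)
    (u : (X.inp.sum Y.inp).dprod) :
    (inl x.S y.S).tangent ((x.mu y).f.eqn (s, u)) =
      x.f.eqn ((inl x.S y.S).dprod s, (inl X.inp Y.inp).dprod u) :=
  tangent_inl_dprodSum_symm _ _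

theorem tangent_inr_mu_eqn (x : Sys X) (y : Sys Y) (s : (x.S.sum y.S).dprod)
    (u : (X.inp.sum Y.inp).dprod) :
    (inr x.S y.S).tangent ((x.mu y).f.eqn (s, u)) =
      y.f.eqn ((inr x.S y.S).dprod s, (inr X.inp Y.inp).dprod u) :=
  tangent_inr_dprodSum_symm _ _

/-- Under a tensor of wiring diagrams, a wire starting in the first summand ends in the first
summand, at the port prescribed by `Φ`. -/
theorem inl_feed_tensor (Φ : X ⟶ Y) (Φ' : X' ⟶ Y') (v : (X.out.sum X'.out).dprod)
    (u : (Y.inp.sum Y'.inp).dprod) :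
    (inl X.inp X'.inp).dprod (feed (Φ ⊗ₘ Φ') v u) =
      feed Φ ((inl X.out X'.out).dprod v) ((inl Y.inp Y'.inp).dprod u) := by
  funext a
  apply eq_of_heq
  -- The cast in the restriction along `inl` is reflexive, so it reduces to evaluation at `Sum.inl
  -- a`.
  change HEq (feed (Φ ⊗ₘ Φ') v u (Sum.inl a)) _
  rcases h : (WD.inn Φ a : X.out ⊕ Y.inp) with b | b
  · exact (feed_inl (Φ ⊗ₘ Φ') v u (b := Sum.inl b)
      ((WD.tensorInn_inl Φ Φ' a).trans (by rw [h]; rfl))).trans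
      (feed_inl Φ ((inl X.out X'.out).dprod v) ((inl Y.inp Y'.inp).dprod u) h).symm
  · exact (feed_inr (Φ ⊗ₘ Φ') v u (b := Sum.inl b)
      ((WD.tensorInn_inl Φ Φ' a).trans (by rw [h]; rfl))).trans
      (feed_inr Φ ((inl X.out X'.out).dprod v) ((inl Y.inp Y'.inp).dprod u) h).symm

theorem inr_feed_tensor (Φ : X ⟶ Y) (Φ' : X' ⟶ Y') (v : (X.out.sum X'.out).dprod)
    (u : (Y.inp.sum Y'.inp).dprod) :
    (inr X.inp X'.inp).dprod (feed (Φ ⊗ₘ Φ') v u) =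
      feed Φ' ((inr X.out X'.out).dprod v) ((inr Y.inp Y'.inp).dprod u) := by
  funext a
  apply eq_of_heq
  change HEq (feed (Φ ⊗ₘ Φ') v u (Sum.inr a)) _
  rcases h : (WD.inn Φ' a : X'.out ⊕ Y'.inp) with b | b
  · exact (feed_inl (Φ ⊗ₘ Φ') v u (b := Sum.inr b)
      ((WD.tensorInn_inr Φ Φ' a).trans (by rw [h]; rfl))).trans
      (feed_inl Φ' ((inr X.out X'.out).dprod v) ((inr Y.inp Y'.inp).dprod u) h).symm
  · exact (feed_inr (Φ ⊗ₘ Φ') v u (b := Sum.inr b)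
      ((WD.tensorInn_inr Φ Φ' a).trans (by rw [h]; rfl))).trans
      (feed_inr Φ' ((inr X.out X'.out).dprod v) ((inr Y.inp Y'.inp).dprod u) h).symm

theorem map_mu (Φ : X ⟶ Y) (Φ' : X' ⟶ Y') (x : Sys X) (x' : Sys X') :
    (x.mu x').map (Φ ⊗ₘ Φ') = (x.map Φ).mu (x'.map Φ') := by
  refine ext_of_S (fun s u => tangent_sum_ext ?_ ?_) (fun s => ?_)
  · refine (tangent_inl_mu_eqn x x' s _).trans (Eq.trans ?_
      (tangent_inl_mu_eqn (x.map Φ) (x'.map Φ') s u).symm)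
    exact congrArg (fun w => x.f.eqn ((inl x.S x'.S).dprod s, w)) (inl_feed_tensor Φ Φ' _ u)
  · refine (tangent_inr_mu_eqn x x' s _).trans (Eq.trans ?_
      (tangent_inr_mu_eqn (x.map Φ) (x'.map Φ') s u).symm)
    exact congrArg (fun w => x'.f.eqn ((inr x.S x'.S).dprod s, w)) (inr_feed_tensor Φ Φ' _ u)
  · funext a
    rcases a with a | a <;> rfl

/-! ### Renamings form a congruence -/

/-- Smoothness is automatic for induced maps and identities, so only the two commutation conditions
remain. Since `dprod` is contravariant, a renaming of `x` into `y` maps states of `y` to states of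
`x`. -/
theorem isRenaming_of {x y : Sys X} {σ : TypedFun x.S y.S} (hσ : Function.Bijective σ)
    (he : ∀ s u, σ.tangent (y.f.eqn (s, u)) = x.f.eqn (σ.dprod s, u))
    (hr : ∀ s, y.f.readout s = x.f.readout (σ.dprod s)) : IsRenaming x y σ :=
  ⟨hσ, σ.isSmooth_dprod, Man.isSmooth_id _, Man.isSmooth_id _, he, hr⟩

namespace IsRenaming

theorem eqn {x y : Sys X} {σ : TypedFun x.S y.S} (h : IsRenaming x y σ) (s : y.S.dprod)
    (u : X.inp.dprod) : σ.tangent (y.f.eqn (s, u)) = x.f.eqn (σ.dprod s, u) :=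
  h.2.eqn_comm s u

theorem readout {x y : Sys X} {σ : TypedFun x.S y.S} (h : IsRenaming x y σ) (s : y.S.dprod) :
    y.f.readout s = x.f.readout (σ.dprod s) :=
  h.2.readout_comm s

theorem refl (x : Sys X) : IsRenaming x x (TypedFun.id x.S) :=
  isRenaming_of Function.bijective_id (fun _ _ => tangent_id _) (fun _ => rfl)

theorem trans {x y z : Sys X} {σ : TypedFun x.S y.S} {τ : TypedFun y.S z.S}
    (h : IsRenaming x y σ) (h' : IsRenaming y z τ) : IsRenaming x z (τ.comp σ) := by
  refine isRenaming_of (h'.1.comp h.1) (fun s u => ?_) (fun s => ?_)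
  · rw [tangent_comp, h'.eqn, h.eqn, dprod_comp]
  · rw [h'.readout, h.readout, dprod_comp]

theorem symm {x y : Sys X} {σ : TypedFun x.S y.S} (h : IsRenaming x y σ) :
    IsRenaming y x (σ.inverse h.1) := by
  have hs : ∀ s : x.S.dprod, σ.dprod ((σ.inverse h.1).dprod s) = s := fun s => by
    rw [← dprod_comp, inverse_comp]; rfl
  refine isRenaming_of (σ.bijective_inverse h.1) (fun s u => ?_) (fun s => ?_)
  -- Writing the state on the left as an image under `σ.dprod` allows the equation of `h` to be used
  -- backwards; the tangent maps of `σ` and its inverse then cancel.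
  · conv_lhs => rw [← hs s]
    rw [← h.eqn, ← tangent_comp, comp_inverse, tangent_id]
  · rw [h.readout, hs]

/-- Feedback depends on the state only through the readout, which a renaming preserves, so both
inner boxes receive the same signal. -/
theorem map {x y : Sys X} {σ : TypedFun x.S y.S} (h : IsRenaming x y σ) (Φ : X ⟶ Y) :
    IsRenaming (x.map Φ) (y.map Φ) σ := by
  refine isRenaming_of h.1 (fun s u => ?_) (fun s => ?_)
  · refine (h.eqn s _).trans ?_
    rw [h.readout]
    rfl
  · exact congrArg (WD.out Φ).dprod (h.readout s)

/-- Restricting `σ.map τ` to a summand gives `σ` or `τ` followed by the inclusion, definitionally.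
On each summand the claim is thus the commutation condition of the corresponding renaming. -/
theorem mu {x y : Sys X} {x' y' : Sys Y} {σ : TypedFun x.S y.S} {τ : TypedFun x'.S y'.S}
    (h : IsRenaming x y σ) (h' : IsRenaming x' y' τ) :
    IsRenaming (x.mu x') (y.mu y') (σ.map τ) := by
  refine isRenaming_of (bijective_map h.1 h'.1)
    (fun s u => tangent_sum_ext ?_ ?_) (fun s => ?_)
  · refine Eq.trans ?_ (tangent_inl_mu_eqn x x' _ u).symm
    refine (tangent_comp (σ.map τ) (inl x.S x'.S) _).symm.trans ?_
    refine (tangent_comp (inl y.S y'.S) σ _).trans ?_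
    refine (congrArg σ.tangent (tangent_inl_mu_eqn y y' s u)).trans ((h.eqn _ _).trans ?_)
    exact congrArg (fun t => x.f.eqn (t, _)) (dprod_comp (inl y.S y'.S) σ s).symm
  · refine Eq.trans ?_ (tangent_inr_mu_eqn x x' _ u).symm
    refine (tangent_comp (σ.map τ) (inr x.S x'.S) _).symm.trans ?_
    refine (tangent_comp (inr y.S y'.S) τ _).trans ?_
    refine (congrArg τ.tangent (tangent_inr_mu_eqn y y' s u)).trans ((h'.eqn _ _).trans ?_)
    exact congrArg (fun t => x'.f.eqn (t, _)) (dprod_comp (inr y.S y'.S) τ s).symm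
  · funext a
    rcases a with a | a
    · exact congrFun (h.readout _) a
    · exact congrFun (h'.readout _) a

end IsRenaming

/-! ### Coherence up to the canonical renamings -/

/-- The nested extensionality splits the tangent vector into the summands of `x`, `y` and `z`. On
each, `assoc` composed with the inclusions for one bracketing is the inclusion for the other, so
both sides restrict to the equation of the same factor. -/
theorem isRenaming_assoc (x : Sys X) (y : Sys Y) (z : Sys Z) :
    IsRenaming (((x.mu y).mu z).map (α_ X Y Z).hom) (x.mu (y.mu z))
      (TypedFun.assoc x.S y.S z.S) := by
  refine isRenaming_of (bijective_assoc _ _ _)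
    (fun s u => tangent_sum_ext (tangent_sum_ext ?_ ?_) ?_) (fun s => ?_)
  -- The associator of boxes only relabels ports, so the signal it feeds is by definition the outer
  -- input reindexed along `assoc`.
  · have e := tangent_inl_mu_eqn (x.mu y) z ((TypedFun.assoc x.S y.S z.S).dprod s)
      ((TypedFun.assoc X.inp Y.inp Z.inp).dprod u)
    refine Eq.trans ?_ (congrArg (inl x.S y.S).tangent e).symm
    refine Eq.trans ?_ (tangent_inl_mu_eqn x y _ _).symm
    refine (congrArg (inl x.S y.S).tangent (tangent_comp (TypedFun.assoc x.S y.S z.S)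
      (inl (x.S.sum y.S) z.S) _)).symm.trans ?_
    refine (tangent_comp ((TypedFun.assoc x.S y.S z.S).comp (inl (x.S.sum y.S) z.S))
      (inl x.S y.S) _).symm.trans ?_
    exact tangent_inl_mu_eqn x (y.mu z) s u
  · have e := tangent_inl_mu_eqn (x.mu y) z ((TypedFun.assoc x.S y.S z.S).dprod s)
      ((TypedFun.assoc X.inp Y.inp Z.inp).dprod u)
    refine Eq.trans ?_ (congrArg (inr x.S y.S).tangent e).symm
    refine Eq.trans ?_ (tangent_inr_mu_eqn x y _ _).symm
    refine (congrArg (inr x.S y.S).tangent (tangent_comp (TypedFun.assoc x.S y.S z.S)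
      (inl (x.S.sum y.S) z.S) _)).symm.trans ?_
    refine (tangent_comp ((TypedFun.assoc x.S y.S z.S).comp (inl (x.S.sum y.S) z.S))
      (inr x.S y.S) _).symm.trans ?_
    refine (tangent_comp (inr x.S (y.S.sum z.S)) (inl y.S z.S) _).trans ?_
    refine (congrArg (inl y.S z.S).tangent (tangent_inr_mu_eqn x (y.mu z) s u)).trans ?_
    exact tangent_inl_mu_eqn y z _ _
  · have e := tangent_inr_mu_eqn (x.mu y) z ((TypedFun.assoc x.S y.S z.S).dprod s)
      ((TypedFun.assoc X.inp Y.inp Z.inp).dprod u)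
    refine Eq.trans ?_ e.symm
    refine (tangent_comp (TypedFun.assoc x.S y.S z.S) (inr (x.S.sum y.S) z.S) _).symm.trans ?_
    refine (tangent_comp (inr x.S (y.S.sum z.S)) (inr y.S z.S) _).trans ?_
    refine (congrArg (inr y.S z.S).tangent (tangent_inr_mu_eqn x (y.mu z) s u)).trans ?_
    exact tangent_inr_mu_eqn y z _ _
  · funext a
    rcases a with a | a | a <;> rfl

/-- The empty summand carries no information; on the other one, `emptySum` after `inr` is the
identity. -/
theorem isRenaming_emptySum (x : Sys X) :
    IsRenaming ((unit.mu x).map (λ_ X).hom) x (TypedFun.emptySum x.S) := by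
  refine isRenaming_of (bijective_emptySum _)
    (fun s u => tangent_sum_ext (tangent_empty_ext _ _) ?_) (fun s => rfl)
  refine Eq.trans ?_ (tangent_inr_mu_eqn unit x ((TypedFun.emptySum x.S).dprod s)
    ((TypedFun.emptySum X.inp).dprod u)).symm
  exact (tangent_comp (TypedFun.emptySum x.S) (inr TFS.empty x.S) _).symm.trans (tangent_id _)

theorem isRenaming_sumEmpty (x : Sys X) :
    IsRenaming ((x.mu unit).map (ρ_ X).hom) x (TypedFun.sumEmpty x.S) := by
  refine isRenaming_of (bijective_sumEmpty _)
    (fun s u => tangent_sum_ext ?_ (tangent_empty_ext _ _)) (fun s => rfl)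
  refine Eq.trans ?_ (tangent_inl_mu_eqn x unit ((TypedFun.sumEmpty x.S).dprod s)
    ((TypedFun.sumEmpty X.inp).dprod u)).symm
  exact (tangent_comp (TypedFun.sumEmpty x.S) (inl x.S TFS.empty) _).symm.trans (tangent_id _)

/-- Precomposing `swap` with one inclusion gives the other, so each factor is recovered from the
opposite summand of `y.mu x`. -/
theorem isRenaming_swap (x : Sys X) (y : Sys Y) :
    IsRenaming ((x.mu y).map (β_ X Y).hom) (y.mu x) (TypedFun.swap x.S y.S) := by
  refine isRenaming_of (bijective_swap _ _)
    (fun s u => tangent_sum_ext ?_ ?_) (fun s => ?_)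
  · refine Eq.trans ?_ (tangent_inl_mu_eqn x y ((TypedFun.swap x.S y.S).dprod s)
      ((TypedFun.swap X.inp Y.inp).dprod u)).symm
    exact (tangent_comp (TypedFun.swap x.S y.S) (inl x.S y.S) _).symm.trans
      (tangent_inr_mu_eqn y x s u)
  · refine Eq.trans ?_ (tangent_inr_mu_eqn x y ((TypedFun.swap x.S y.S).dprod s)
      ((TypedFun.swap X.inp Y.inp).dprod u)).symm
    exact (tangent_comp (TypedFun.swap x.S y.S) (inr x.S y.S) _).symm.trans
      (tangent_inl_mu_eqn y x s u)
  · funext a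
    rcases a with a | a <;> rfl

/-! ### The lax symmetric monoidal functor on classes -/

/-- Two open systems on a box are equivalent if they differ by a renaming of state variables. -/
instance renamingSetoid (X : Box) : Setoid (Sys X) where
  r x y := ∃ σ, IsRenaming x y σ
  iseqv :=
    { refl := fun x => ⟨_, IsRenaming.refl x⟩
      symm := fun h => h.elim fun _ h => ⟨_, h.symm⟩
      trans := fun h h' => h.elim fun _ h => h'.elim fun _ h' => ⟨_, h.trans h'⟩ }

/-- Open systems on a box up to renaming of state variables. -/
abbrev Class (X : Box) : Type 1 := Quotient (renamingSetoid X)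

namespace Class

def map (Φ : X ⟶ Y) : Class X → Class Y :=
  Quotient.map (Sys.map Φ) fun _ _ h => h.imp fun _ h => h.map Φ

def mu : Class X → Class Y → Class (X ⊗ Y) :=
  Quotient.map₂ Sys.mu fun _ _ h _ _ h' =>
    h.elim fun _ h => h'.elim fun _ h' => ⟨_, h.mu h'⟩

end Class

/-- The functor of open systems up to renaming of state variables. -/
def classFunctor : Box ⥤ Type 1 where
  obj := Class
  map Φ := ↾(Class.map Φ)
  map_id X := by
    ext x
    induction x using Quotient.inductionOn with | _ x
    exact congrArg (Quotient.mk _) (map_id x)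
  map_comp Φ Ψ := by
    ext x
    induction x using Quotient.inductionOn with | _ x
    exact congrArg (Quotient.mk _) (map_comp Φ Ψ x)

/-- All axioms are checked on representatives. The naturality axioms already hold strictly by
`map_mu`; associativity, unitality and symmetry are the canonical renamings, made equalities by
`Quotient.sound`. -/
instance : classFunctor.LaxBraided where
  ε := ↾fun _ => (⟦unit⟧ : Class (𝟙_ Box))
  μ X Y := ↾fun p : Class X × Class Y => p.1.mu p.2
  μ_natural_left {X Y} Φ X' := by
    ext p
    obtain ⟨x, y⟩ := p
    induction x using Quotient.inductionOn with | _ x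
    induction y using Quotient.inductionOn with | _ y
    exact congrArg (Quotient.mk _) (map_mu Φ (𝟙 X') x y).symm
  μ_natural_right {X Y} X' Φ := by
    ext p
    obtain ⟨x, y⟩ := p
    induction x using Quotient.inductionOn with | _ x
    induction y using Quotient.inductionOn with | _ y
    exact congrArg (Quotient.mk _) (map_mu (𝟙 X') Φ x y).symm
  associativity X Y Z := by
    ext p
    obtain ⟨⟨x, y⟩, z⟩ := p
    induction x using Quotient.inductionOn with | _ x
    induction y using Quotient.inductionOn with | _ y
    induction z using Quotient.inductionOn with | _ z
    exact Quotient.sound (s := renamingSetoid _) ⟨_, isRenaming_assoc x y z⟩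
  left_unitality X := by
    ext p
    obtain ⟨_, x⟩ := p
    induction x using Quotient.inductionOn with | _ x
    -- The unitality axiom has the bare unitor on its left-hand side, opposite to the direction of
    -- the renaming.
    exact (Quotient.sound (s := renamingSetoid _) ⟨_, isRenaming_emptySum x⟩).symm
  right_unitality X := by
    ext p
    obtain ⟨x, _⟩ := p
    induction x using Quotient.inductionOn with | _ x
    exact (Quotient.sound (s := renamingSetoid _) ⟨_, isRenaming_sumEmpty x⟩).symm
  braided X Y := by
    ext p
    obtain ⟨x, y⟩ := p
    induction x using Quotient.inductionOn with | _ x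
    induction y using Quotient.inductionOn with | _ y
    exact Quotient.sound (s := renamingSetoid _) ⟨_, isRenaming_swap x y⟩

/-- The projection from open systems to open systems up to renaming of state variables. -/
def projection : functorG (fun _ => map_id) map_comp ⟶ classFunctor where
  app X := ↾fun x : Sys X => (⟦x⟧ : Class X)
  naturality _ _ _ := rfl

end Sys

end OpenDyn

end

/-! ### The proposition -/

theorem mainTheorem2 :
    ∃ (map_id : ∀ (X : Box) (x : Sys X), x.map (𝟙 X) = x)
      (map_comp : ∀ {X Y Z : Box} (Φ : X ⟶ Y) (Ψ : Y ⟶ Z) (x : Sys X),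
        x.map (Φ ≫ Ψ) = (x.map Φ).map Ψ),
      -- naturality of the coherence map
      (∀ {X X' Y Y' : Box} (Φ : X ⟶ Y) (Φ' : X' ⟶ Y') (x : Sys X) (x' : Sys X'),
        (x.mu x').map (Φ ⊗ₘ Φ') = (x.map Φ).mu (x'.map Φ')) ∧
      -- associativity, unitality and symmetry, up to the canonical renamings of state variables
      (∀ {X Y Z : Box} (x : Sys X) (y : Sys Y) (z : Sys Z),
        Sys.IsRenaming (((x.mu y).mu z).map (α_ X Y Z).hom) (x.mu (y.mu z))
          (TypedFun.assoc x.S y.S z.S)) ∧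
      (∀ {X : Box} (x : Sys X),
        Sys.IsRenaming ((Sys.unit.mu x).map (λ_ X).hom) x (TypedFun.emptySum x.S)) ∧
      (∀ {X : Box} (x : Sys X),
        Sys.IsRenaming ((x.mu Sys.unit).map (ρ_ X).hom) x (TypedFun.sumEmpty x.S)) ∧
      (∀ {X Y : Box} (x : Sys X) (y : Sys Y),
        Sys.IsRenaming ((x.mu y).map (β_ X Y).hom) (y.mu x) (TypedFun.swap x.S y.S)) ∧
      -- after identifying systems that differ by a renaming of state variables, this is a lax symmetric monoidal functor
      ∃ (GBar : Box ⥤ Type 1) (π : functorG map_id map_comp ⟶ GBar) (L : GBar.LaxBraided),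
        (∀ (X : Box) (x y : Sys X), π.app X x = π.app X y ↔ ∃ σ, Sys.IsRenaming x y σ) ∧
        (∀ X : Box, Function.Surjective (π.app X)) ∧
        (∀ (X Y : Box) (x : Sys X) (y : Sys Y),
          L.μ X Y (π.app X x, π.app Y y) = π.app (X ⊗ Y) (x.mu y)) ∧
        L.ε PUnit.unit = π.app (𝟙_ Box) Sys.unit :=
  ⟨fun _ => Sys.map_id, Sys.map_comp, Sys.map_mu, Sys.isRenaming_assoc, Sys.isRenaming_emptySum,
    Sys.isRenaming_sumEmpty, Sys.isRenaming_swap, Sys.classFunctor, Sys.projection, inferInstance,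
    -- The relation of `renamingSetoid` is literally the existence of a renaming, and the structure
    -- maps on classes compute on representatives.
    fun _ _ _ => Quotient.eq, fun _ => Quotient.mk_surjective, fun _ _ _ _ => rfl, rfl⟩
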